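/- Let $\mathbb{D}_2^\infty=\{\zeta=(\zeta_1,\zeta_2,\dots)\in\ell^2:\ |\zeta_n|<1 \text{ for all } n\}$. For a complex Hilbert space $\mathcal{E}$ (not necessarily separable), let $H^2_{\mathcal{E}}(\mathbb{D}_2^\infty)$ be the Hilbert space of all functions $F(\zeta)=\sum_{\alpha}\zeta^\alpha x_\alpha$ on $\mathbb{D}_2^\infty$, where $\alpha$ runs over the finitely supported sequences of nonnegative integers, $\zeta^\alpha=\prod_n\zeta_n^{\alpha_n}$, $x_\alpha\in\mathcal{E}$ and $\|F\|^2=\sum_\alpha\|x_\alpha\|^2<\infty$. Let $M_{\zeta_n}$ denote multiplication by the $n$-th coordinate. A submodule of $H^2_{\mathcal{E}}(\mathbb{D}_2^\infty)$ is a closed subspace invariant under every $M_{\zeta_n}$. A submodule $\mathcal{S}$ is doubly commuting if the restrictions $R_n=M_{\zeta_n}|_{\mathcal{S}}$, as operators on the Hilbert space $\mathcal{S}$, satisfy $R_mR_n=R_nR_m$ and $R_m^*R_n=R_nR_m^*$ for all $m\ne n$. For Hilbert spaces $\mathcal{F},\mathcal{E}$, let $H^\infty_{\mathcal{B}(\mathcal{F},\mathcal{E})}(\mathbb{D}_2^\infty)$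 be the set of uniformly bounded holomorphic functions $\Psi:\mathbb{D}_2^\infty\to\mathcal{B}(\mathcal{F},\mathcal{E})$, where $\mathcal{B}(\mathcal{F},\mathcal{E})$ is the space of bounded linear operators with the operator norm; such a $\Psi$ is called inner if the multiplication operator $M_\Psi:H^2_{\mathcal{F}}(\mathbb{D}_2^\infty)\to H^2_{\mathcal{E}}(\mathbb{D}_2^\infty)$, $(M_\Psi G)(\zeta)=\Psi(\zeta)G(\zeta)$, is an isometry. **Theorem.** Let $\mathcal{E}$ be a complex Hilbert space and let $\mathcal{S}$ be a submodule of $H^2_{\mathcal{E}}(\mathbb{D}_2^\infty)$. Then $\mathcal{S}$ is doubly commuting if and only if there exist a complex Hilbert space $\mathcal{F}$ and an inner function $\Psi\in H^\infty_{\mathcal{B}(\mathcal{F},\mathcal{E})}(\mathbb{D}_2^\infty)$ such that $$\mathcal{S}=\Psi H^2_{\mathcal{F}}(\mathbb{D}_2^\infty)=\{\Psi G:\ G\in H^2_{\mathcal{F}}(\mathbb{D}_2^\infty)\}.$$ -/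

import Mathlib

open scoped ENNReal

universe u

noncomputable section

namespace HardyInfinite

/-- The finitely supported sequences of nonnegative integers. -/
abbrev MultiIndex : Type := ℕ →₀ ℕ

/-- The complex Hilbert space of square summable sequences. -/
abbrev EllTwo : Type := lp (fun _ : ℕ => ℂ) 2

/-- Hilbert's multidisk: the points `ζ` of `ℓ²` with `|ζ n| < 1` for all `n`. -/
def multidisk : Set EllTwo := {ζ | ∀ n, ‖ζ n‖ < 1}

/-- The monomial `ζ ^ α = ∏ n, (ζ n) ^ (α n)`. -/
def monomial (ζ : EllTwo) (α : MultiIndex) : ℂ := α.prod fun n k => ζ n ^ k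

/-- The `E`-valued Hardy space over the multidisk. An element
`F(ζ) = ∑ α, ζ ^ α • x α`, `∑ α, ‖x α‖² < ∞`, is recorded by its family of coefficients `x`,
with norm `‖F‖² = ∑ α, ‖x α‖²`; its values are given by `HardySpace.eval` below, the series
converges absolutely on the multidisk (`HardySpace.summable_eval`), and the values there
determine the element (`HardySpace.eval_injective`). -/
abbrev HardySpace (E : Type*) [NormedAddCommGroup E] : Type _ :=
  lp (fun _ : MultiIndex => E) 2

section Hardy

variable {E : Type*} [NormedAddCommGroup E] [InnerProductSpace ℂ E]

/-- The value at `ζ` of an element of the Hardy space. -/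
def HardySpace.eval (F : HardySpace E) (ζ : EllTwo) : E := ∑' α, monomial ζ α • F α

theorem monomial_add (ζ : EllTwo) (α β : MultiIndex) :
    monomial ζ (α + β) = monomial ζ α * monomial ζ β :=
  Finsupp.prod_add_index' (fun _ => pow_zero _) (fun _ _ _ => pow_add _ _ _)

theorem monomial_single (ζ : EllTwo) (n k : ℕ) :
    monomial ζ (Finsupp.single n k) = ζ n ^ k :=
  Finsupp.prod_single_index (pow_zero _)

theorem summable_norm_monomial_sq {ζ : EllTwo} (hζ : ζ ∈ multidisk) :
    Summable fun α => ‖monomial ζ α‖ ^ 2 := by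
  set r : ℕ → ℝ := fun n => ‖ζ n‖ ^ 2 with hr
  have hr0 : ∀ n, 0 ≤ r n := fun n => by positivity
  have hr1 : ∀ n, r n < 1 := fun n => by
    have := hζ n
    have h0 := norm_nonneg (ζ n)
    simp only [hr]
    nlinarith
  have hsr : Summable r := by
    have := (lp.memℓp ζ).summable (by norm_num)
    simpa [hr] using this
  have hsu : Summable fun n => r n / (1 - r n) := by
    have h1 : ∀ᶠ n in Filter.cofinite, r n < 1 / 2 :=
      hsr.tendsto_cofinite_zero.eventually (gt_mem_nhds (by norm_num))
    refine Summable.of_norm_bounded_eventually (hsr.mul_left 2) ?_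
    filter_upwards [h1] with n hn
    rw [Real.norm_of_nonneg (div_nonneg (hr0 n) (by linarith [hr1 n])),
      div_le_iff₀ (by linarith [hr1 n])]
    nlinarith [hr0 n]
  have hmon : ∀ α, ‖monomial ζ α‖ ^ 2 = α.prod fun n k => r n ^ k := by
    intro α
    simp only [monomial, Finsupp.prod, norm_prod, norm_pow, hr, ← Finset.prod_pow]
    exact Finset.prod_congr rfl fun n _ => by ring
  refine summable_of_sum_le (c := Real.exp (∑' n, r n / (1 - r n)))
    (fun α => by positivity) fun u => ?_
  set s : Finset ℕ := u.sup Finsupp.support with hs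
  set K : ℕ := (u.sup fun α => s.sup α) + 1 with hK
  have hsub : u ⊆ s.finsupp fun _ => Finset.range K := by
    intro α hα
    rw [Finset.mem_finsupp_iff]
    have h1 : α.support ⊆ s := Finset.le_sup (f := Finsupp.support) hα
    refine ⟨h1, fun n hn => ?_⟩
    have h2 : α n ≤ s.sup α := Finset.le_sup (f := α) hn
    have h3 : s.sup α ≤ u.sup fun α => s.sup α :=
      Finset.le_sup (f := fun α : MultiIndex => s.sup α) hα
    rw [Finset.mem_range]
    omega
  calc ∑ α ∈ u, ‖monomial ζ α‖ ^ 2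
      ≤ ∑ α ∈ s.finsupp fun _ => Finset.range K, ‖monomial ζ α‖ ^ 2 :=
        Finset.sum_le_sum_of_subset_of_nonneg hsub fun _ _ _ => by positivity
    _ = ∏ n ∈ s, ∑ k ∈ Finset.range K, r n ^ k := by
        rw [Finset.prod_sum, Finset.finsupp, Finset.sum_map]
        refine Finset.sum_congr (by congr!) fun p hp => ?_
        rw [hmon, Finsupp.prod_of_support_subset (s := s)]
        · rw [← Finset.prod_attach]
          refine Finset.prod_congr rfl fun n _ => ?_
          simp [Finsupp.indicator_apply]
        · simpa using Finsupp.support_indicator_subset _ _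
        · intros; simp
    _ ≤ ∏ n ∈ s, Real.exp (r n / (1 - r n)) := by
        refine Finset.prod_le_prod
          (fun n _ => Finset.sum_nonneg fun k _ => pow_nonneg (hr0 n) k) fun n _ => ?_
        have h1 : ∑ k ∈ Finset.range K, r n ^ k ≤ (1 - r n)⁻¹ := by
          rw [← tsum_geometric_of_lt_one (hr0 n) (hr1 n)]
          exact (summable_geometric_of_lt_one (hr0 n) (hr1 n)).sum_le_tsum _
            fun k _ => pow_nonneg (hr0 n) k
        have h2 : (1 - r n)⁻¹ = r n / (1 - r n) + 1 := by
          have : 1 - r n ≠ 0 := by linarith [hr1 n]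
          field_simp
          ring
        exact h1.trans (h2 ▸ Real.add_one_le_exp _)
    _ = Real.exp (∑ n ∈ s, r n / (1 - r n)) := (Real.exp_sum _ _).symm
    _ ≤ _ := Real.exp_le_exp.2 <| hsu.sum_le_tsum _ fun n _ =>
        div_nonneg (hr0 n) (by linarith [hr1 n])

theorem HardySpace.summable_norm_eval (F : HardySpace E) {ζ : EllTwo} (hζ : ζ ∈ multidisk) :
    Summable fun α => ‖monomial ζ α • F α‖ := by
  have hF : Summable fun α => ‖F α‖ ^ 2 := by
    have := (lp.memℓp F).summable (by norm_num)
    simpa using this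
  refine Summable.of_nonneg_of_le (fun _ => norm_nonneg _) (fun α => ?_)
    ((summable_norm_monomial_sq hζ).add hF)
  rw [norm_smul]
  nlinarith [sq_nonneg (‖monomial ζ α‖ - ‖F α‖), norm_nonneg (monomial ζ α), norm_nonneg (F α)]

theorem HardySpace.summable_eval [CompleteSpace E] (F : HardySpace E) {ζ : EllTwo}
    (hζ : ζ ∈ multidisk) : Summable fun α => monomial ζ α • F α :=
  (F.summable_norm_eval hζ).of_norm

theorem monomial_smul (t : ℂ) (ζ : EllTwo) (α : MultiIndex) :
    monomial (t • ζ) α = t ^ α.degree * monomial ζ α := by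
  rw [Finsupp.degree_apply, monomial, monomial, Finsupp.prod, Finsupp.prod,
    ← Finset.prod_pow_eq_pow_sum, ← Finset.prod_mul_distrib]
  refine Finset.prod_congr rfl fun n _ => ?_
  rw [← mul_pow]
  rfl

theorem smul_mem_multidisk {t : ℂ} (ht : ‖t‖ ≤ 1) {ζ : EllTwo} (hζ : ζ ∈ multidisk) :
    t • ζ ∈ multidisk := fun n => by
  rw [lp.coeFn_smul, Pi.smul_apply, norm_smul]
  have := hζ n
  nlinarith [norm_nonneg (ζ n), norm_nonneg t]

theorem HardySpace.eq_zero_of_eval_eq_zero [CompleteSpace E] (F : HardySpace E)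
    (h : ∀ ζ ∈ multidisk, F.eval ζ = 0) : F = 0 := by
  ext β
  refine ext_inner_left ℂ fun y => ?_
  rw [lp.coeFn_zero, Pi.zero_apply, inner_zero_right]
  set c : MultiIndex → ℂ := fun α => inner ℂ y (F α) with hc
  -- the homogeneous components vanish on the multidisk
  have key : ∀ ζ ∈ multidisk, ∀ k : ℕ,
      ∑' α : (Finsupp.degree : MultiIndex → ℕ) ⁻¹' {k}, monomial ζ α * c α = 0 := by
    intro ζ hζ
    have h1 : ∀ t : ℂ, ‖t‖ ≤ 1 → HasSum (fun k : ℕ => t ^ k •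
        ∑' α : (Finsupp.degree : MultiIndex → ℕ) ⁻¹' {k}, monomial ζ α * c α) 0 := by
      intro t ht
      have h2 := (F.summable_eval (smul_mem_multidisk ht hζ)).hasSum
      rw [← HardySpace.eval, h _ (smul_mem_multidisk ht hζ)] at h2
      have h3 := h2.mapL (innerSL ℂ y)
      rw [map_zero] at h3
      have h4 := h3.tsum_fiberwise (Finsupp.degree : MultiIndex → ℕ)
      refine h4.congr_fun ?_
      intro k
      rw [smul_eq_mul, ← tsum_mul_left]
      refine tsum_congr fun α => ?_
      have hα : (α : MultiIndex).degree = k := α.2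
      rw [monomial_smul, hα]
      simp [hc, mul_assoc]
    set a : ℕ → ℂ := fun k =>
      ∑' α : (Finsupp.degree : MultiIndex → ℕ) ⁻¹' {k}, monomial ζ α * c α with ha
    let P : FormalMultilinearSeries ℂ ℂ ℂ := fun k =>
      ContinuousMultilinearMap.mkPiRing ℂ (Fin k) (a k)
    have h2 : HasFPowerSeriesAt (fun _ : ℂ => (0 : ℂ)) P 0 := by
      refine hasFPowerSeriesAt_iff.2 ?_
      filter_upwards [Metric.ball_mem_nhds (0 : ℂ) one_pos] with t ht
      simpa [P, FormalMultilinearSeries.coeff] using h1 t (by simpa using (mem_ball_zero_iff.1 ht).le)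
    intro k
    have h3 := congrFun h2.eq_zero k
    have h4 := congrArg (fun m => m fun _ => (1 : ℂ)) h3
    simpa [P] using h4
  -- the part of the component of the degree of `β` in the variables of `β` is a polynomial
  set s : Finset ℕ := β.support with hs
  set A : Finset MultiIndex :=
    (s.finsupp fun _ => Finset.range (β.degree + 1)).filter fun α => α.degree = β.degree with hA
  have hmemA : ∀ α, α ∈ A ↔ α.support ⊆ s ∧ α.degree = β.degree := by
    intro α
    rw [hA, Finset.mem_filter, Finset.mem_finsupp_iff]
    refine ⟨fun h => ⟨h.1.1, h.2⟩, fun h => ⟨⟨h.1, fun n _ => ?_⟩, h.2⟩⟩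
    rw [Finset.mem_range, ← h.2]
    exact Nat.lt_succ_of_le (Finsupp.le_degree n α)
  set p : MvPolynomial ℕ ℂ := ∑ α ∈ A, MvPolynomial.monomial α (c α) with hp
  have hp0 : p = 0 := by
    refine MvPolynomial.funext_set (fun _ => Metric.ball (0 : ℂ) 1)
      (fun _ => infinite_of_mem_nhds 0 (Metric.ball_mem_nhds 0 one_pos)) fun v hv => ?_
    have hv' : ∀ n, ‖v n‖ < 1 := fun n => by simpa using hv n (Set.mem_univ n)
    set ζ : EllTwo := ∑ n ∈ s, lp.single 2 n (v n) with hζ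
    have hζv : ∀ n, ζ n = if n ∈ s then v n else 0 := by
      intro n
      rw [hζ, lp.coeFn_sum, Finset.sum_apply]
      simp [Pi.single_apply]
    have hζm : ζ ∈ multidisk := by
      intro n
      rw [hζv]
      split_ifs
      · exact hv' n
      · simp
    have h1 := key ζ hζm β.degree
    have h2 : ∑' α : (Finsupp.degree : MultiIndex → ℕ) ⁻¹' {β.degree}, monomial ζ α * c α
        = ∑ α ∈ A, monomial ζ α * c α := by
      rw [tsum_subtype ((Finsupp.degree : MultiIndex → ℕ) ⁻¹' {β.degree})
        (fun α => monomial ζ α * c α), tsum_eq_sum (s := A)]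
      · refine Finset.sum_congr rfl fun α hα => ?_
        exact Set.indicator_of_mem (by simpa using ((hmemA α).1 hα).2) _
      · intro α hα
        by_cases hd : α.degree = β.degree
        · rw [Set.indicator_of_mem (by simpa using hd)]
          have : ¬ α.support ⊆ s := fun h' => hα ((hmemA α).2 ⟨h', hd⟩)
          obtain ⟨n, hn, hns⟩ := Finset.not_subset.1 this
          have : monomial ζ α = 0 := by
            refine Finset.prod_eq_zero hn ?_
            have : ζ n = 0 := by rw [hζv, if_neg hns]
            simp only [this]
            exact zero_pow (Finsupp.mem_support_iff.1 hn)
          rw [this, zero_mul]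
        · exact Set.indicator_of_notMem (by simpa using hd) _
    rw [h2] at h1
    rw [map_zero, hp, map_sum, ← h1]
    refine Finset.sum_congr rfl fun α hα => ?_
    rw [MvPolynomial.eval_monomial, mul_comm]
    congr 1
    refine Finset.prod_congr rfl fun n hn => ?_
    have : ζ n = v n := by rw [hζv, if_pos (((hmemA α).1 hα).1 hn)]
    simp only [this]
  have := congrArg (MvPolynomial.coeff β) hp0
  rw [hp, MvPolynomial.coeff_sum] at this
  simp only [MvPolynomial.coeff_monomial, MvPolynomial.coeff_zero, Finset.sum_ite_eq'] at this
  rwa [if_pos ((hmemA β).2 ⟨subset_rfl, rfl⟩)] at this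

theorem HardySpace.eval_add [CompleteSpace E] (F G : HardySpace E) {ζ : EllTwo}
    (hζ : ζ ∈ multidisk) : (F + G).eval ζ = F.eval ζ + G.eval ζ := by
  simp only [HardySpace.eval, lp.coeFn_add, Pi.add_apply, smul_add]
  exact (F.summable_eval hζ).tsum_add (G.summable_eval hζ)

theorem HardySpace.eval_smul (c : ℂ) (F : HardySpace E) (ζ : EllTwo) :
    (c • F).eval ζ = c • F.eval ζ := by
  simp only [HardySpace.eval, lp.coeFn_smul, Pi.smul_apply]
  rw [← tsum_const_smul'']
  exact tsum_congr fun α => smul_comm _ _ _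

/-- An element of the Hardy space is determined by its values on the multidisk. -/
theorem HardySpace.eval_injective [CompleteSpace E] {F G : HardySpace E}
    (h : ∀ ζ ∈ multidisk, F.eval ζ = G.eval ζ) : F = G := by
  rw [← sub_eq_zero]
  refine HardySpace.eq_zero_of_eval_eq_zero _ fun ζ hζ => ?_
  rw [sub_eq_add_neg, ← neg_one_smul ℂ G, HardySpace.eval_add _ _ hζ, HardySpace.eval_smul,
    h ζ hζ, neg_one_smul, add_neg_cancel]

theorem add_single_injective (n : ℕ) :
    Function.Injective fun α : MultiIndex => α + Finsupp.single n 1 :=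
  fun _ _ h => add_right_cancel h

/-- Coefficients of `ζ n * F(ζ)`: the coefficient of `ζ ^ (α + e n)` is that of `ζ ^ α` in `F`,
and the coefficients at the multi-indices not of this form vanish. -/
def shiftCoeff {X : Type*} [Zero X] (n : ℕ) (x : MultiIndex → X) : MultiIndex → X :=
  Function.extend (fun α : MultiIndex => α + Finsupp.single n 1) x 0

theorem shiftCoeff_add_single {X : Type*} [Zero X] (n : ℕ) (x : MultiIndex → X) (α : MultiIndex) :
    shiftCoeff n x (α + Finsupp.single n 1) = x α :=
  (add_single_injective n).extend_apply _ _ _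

theorem shiftCoeff_eq_zero {X : Type*} [Zero X] (n : ℕ) (x : MultiIndex → X) {β : MultiIndex}
    (h : β ∉ Set.range fun α : MultiIndex => α + Finsupp.single n 1) :
    shiftCoeff n x β = 0 :=
  Function.extend_apply' _ _ _ (by simpa using h)

theorem shiftCoeff_add {X : Type*} [AddZeroClass X] (n : ℕ) (x y : MultiIndex → X) :
    shiftCoeff n (x + y) = shiftCoeff n x + shiftCoeff n y := by
  ext β
  by_cases h : β ∈ Set.range fun α : MultiIndex => α + Finsupp.single n 1
  · obtain ⟨α, rfl⟩ := h
    simp only [Pi.add_apply, shiftCoeff_add_single]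
  · simp only [Pi.add_apply, shiftCoeff_eq_zero n _ h, add_zero]

theorem shiftCoeff_smul (n : ℕ) (c : ℂ) (x : MultiIndex → E) :
    shiftCoeff n (c • x) = c • shiftCoeff n x := by
  ext β
  by_cases h : β ∈ Set.range fun α : MultiIndex => α + Finsupp.single n 1
  · obtain ⟨α, rfl⟩ := h
    simp only [Pi.smul_apply, shiftCoeff_add_single]
  · simp only [Pi.smul_apply, shiftCoeff_eq_zero n _ h, smul_zero]

theorem memℓp_shiftCoeff {X : Type*} [NormedAddCommGroup X] (n : ℕ) (F : HardySpace X) :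
    Memℓp (shiftCoeff n (F : MultiIndex → X)) 2 := by
  refine memℓp_gen ?_
  rw [← (add_single_injective n).summable_iff]
  · refine ((lp.memℓp F).summable (by norm_num)).congr fun α => ?_
    simp only [Function.comp, shiftCoeff_add_single]
  · intro β hβ
    rw [shiftCoeff_eq_zero n _ hβ]
    norm_num

/-- The coordinate multiplication operator `M n`, `(M n F)(ζ) = ζ n * F(ζ)`; see
`eval_coordMul`. -/
def coordMul (E : Type*) [NormedAddCommGroup E] [InnerProductSpace ℂ E] (n : ℕ) :
    HardySpace E →ₗᵢ[ℂ] HardySpace E where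
  toFun F := ⟨shiftCoeff n (F : MultiIndex → E), memℓp_shiftCoeff n F⟩
  map_add' F G := Subtype.ext (shiftCoeff_add n (F : MultiIndex → E) (G : MultiIndex → E))
  map_smul' c F := Subtype.ext (shiftCoeff_smul n c (F : MultiIndex → E))
  norm_map' F := by
    have h2 : 0 < (2 : ℝ≥0∞).toReal := by norm_num
    change ‖(⟨shiftCoeff n (F : MultiIndex → E), memℓp_shiftCoeff n F⟩ : HardySpace E)‖ = ‖F‖
    rw [lp.norm_eq_tsum_rpow h2, lp.norm_eq_tsum_rpow h2]
    congr 1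
    change ∑' β, ‖shiftCoeff n (F : MultiIndex → E) β‖ ^ (2 : ℝ≥0∞).toReal = _
    rw [← (add_single_injective n).tsum_eq]
    · exact tsum_congr fun α => by simp only [shiftCoeff_add_single]
    · intro β hβ
      by_contra h
      refine hβ ?_
      simp only [shiftCoeff_eq_zero n _ h]
      norm_num

theorem eval_coordMul (n : ℕ) (F : HardySpace E) (ζ : EllTwo) :
    (coordMul E n F).eval ζ = ζ n • F.eval ζ := by
  change ∑' β, monomial ζ β • shiftCoeff n (F : MultiIndex → E) β = _
  rw [← (add_single_injective n).tsum_eq]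
  · rw [HardySpace.eval, ← tsum_const_smul'']
    refine tsum_congr fun α => ?_
    simp only [shiftCoeff_add_single, monomial_add, monomial_single, pow_one, smul_smul]
    rw [mul_comm]
  · intro β hβ
    by_contra h
    exact hβ (by simp only [shiftCoeff_eq_zero n _ h, smul_zero])

/-- Two bounded operators `A`, `B` on a Hilbert space are doubly commuting if `A B = B A` and
`A* B = B A*`. A sequence is doubly commuting if any two of its members (with different indices)
are. -/
def DoublyCommuting {H : Type*} [NormedAddCommGroup H] [InnerProductSpace ℂ H] [CompleteSpace H]
    (T : ℕ → H →L[ℂ] H) : Prop :=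
  ∀ m n, m ≠ n → T m ∘L T n = T n ∘L T m ∧
    ContinuousLinearMap.adjoint (T m) ∘L T n = T n ∘L ContinuousLinearMap.adjoint (T m)

/-- A submodule of the Hardy module: a closed subspace that is invariant under all coordinate
multiplication operators. -/
structure HardySubmodule (E : Type*) [NormedAddCommGroup E] [InnerProductSpace ℂ E] extends
    Submodule ℂ (HardySpace E) where
  isClosed' : IsClosed (carrier : Set (HardySpace E))
  coordMul_mem' : ∀ n, ∀ F ∈ carrier, coordMul E n F ∈ carrier

instance [CompleteSpace E] (S : HardySubmodule E) : CompleteSpace S.toSubmodule :=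
  S.isClosed'.completeSpace_coe

/-- The restriction of the `n`-th coordinate multiplication operator to a submodule `S`, as an
operator on the Hilbert space `S`. -/
def HardySubmodule.restriction (S : HardySubmodule E) (n : ℕ) :
    S.toSubmodule →L[ℂ] S.toSubmodule :=
  (coordMul E n).toContinuousLinearMap.restrict (S.coordMul_mem' n)

def HardySubmodule.IsDoublyCommuting [CompleteSpace E] (S : HardySubmodule E) : Prop :=
  DoublyCommuting S.restriction

variable {F : Type*} [NormedAddCommGroup F] [InnerProductSpace ℂ F]

/-- `Ψ` is a uniformly bounded holomorphic operator-valued function on the multidisk (an open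
subset of `ℓ²`). The values of `Ψ` outside the multidisk play no role. -/
structure IsBoundedHolomorphic (Ψ : EllTwo → F →L[ℂ] E) : Prop where
  differentiableOn : DifferentiableOn ℂ Ψ multidisk
  bounded : ∃ C : ℝ, ∀ ζ ∈ multidisk, ‖Ψ ζ‖ ≤ C

/-- `T` is the multiplication operator `M_Ψ`, that is, `(T G)(ζ) = Ψ(ζ) G(ζ)` on the
multidisk. Since values determine elements, there is at most one such `T`. -/
def IsMultiplicationOperator (Ψ : EllTwo → F →L[ℂ] E) (T : HardySpace F →L[ℂ] HardySpace E) :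
    Prop :=
  ∀ G : HardySpace F, ∀ ζ ∈ multidisk, (T G).eval ζ = Ψ ζ (G.eval ζ)

/-- `Ψ` is an inner function: it is bounded and holomorphic on the multidisk, and the
multiplication operator `M_Ψ` is an isometry. -/
structure IsInner (Ψ : EllTwo → F →L[ℂ] E) : Prop where
  isBoundedHolomorphic : IsBoundedHolomorphic Ψ
  isometry : ∃ T : HardySpace F →L[ℂ] HardySpace E, IsMultiplicationOperator Ψ T ∧ Isometry T

/-- The set `Ψ H²_F` of all elements of the `E`-valued Hardy space of the form
`ζ ↦ Ψ(ζ) G(ζ)`, with `G` in the `F`-valued Hardy space. -/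
def mulImage (Ψ : EllTwo → F →L[ℂ] E) : Set (HardySpace E) :=
  {H | ∃ G : HardySpace F, ∀ ζ ∈ multidisk, H.eval ζ = Ψ ζ (G.eval ζ)}

end Hardy

end HardyInfinite
end

open scoped Topology
open Filter Metric

noncomputable section

/-! If `S` is doubly commuting, let `W` be its wandering subspace, the common kernel of all `R n`*.
Double commutation makes the subspaces `ζ ^ α W` pairwise orthogonal (`orthogonalFamily_monomial`).
They span a dense subspace of `S`: the complement of their span reduces every `R n` and contains no
nonzero wandering vector, which forces its elements to vanish to every order at the origin
(`iSup_range_monomial_topologicalClosure_eq_top`). Filtering by degree treats all variables at once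
and avoids an infinite product of one-variable Wold projections.

Hence `∑ ζ ^ α w_α ↦ ∑ ζ ^ α j(w_α)` is a unitary from `H²_W` onto `S`, namely multiplication by
`Ψ(ζ) = ` evaluation at `ζ` on `W`. The analytic work is to show that `Ψ` is holomorphic in operator
norm: its monomial series need not converge absolutely, so `Ψ` is treated as a pointwise limit of
locally bounded holomorphic partial sums (`differentiableAt_of_tendsto_of_norm_le`). Szegő kernels
give `‖Ψ ζ‖ ≤ 1`.

Conversely, `M_Ψ` is a unitary onto `S` that intertwines the coordinate multiplications, and these
doubly commute on the full Hardy space. -/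

namespace HardyInfinite

/-! ### Pointwise limits of bounded holomorphic maps between normed spaces. -/

section BoundedLimits

variable {X Y : Type*} [NormedAddCommGroup X] [NormedSpace ℂ X] [NormedAddCommGroup Y]
  [NormedSpace ℂ Y] {x : X} {r M : ℝ}

theorem norm_fderiv_le_of_norm_le_on_ball {f : X → Y} (hr : 0 < r)
    (hd : DifferentiableOn ℂ f (ball x r)) (hM : ∀ y ∈ ball x r, ‖f y‖ ≤ M) :
    ‖fderiv ℂ f x‖ ≤ 2 * M / r := by
  refine Complex.norm_fderiv_le_div_of_mapsTo_ball hd (fun y hy => ?_) hr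
  rw [mem_closedBall, dist_eq_norm]
  linarith [norm_sub_le (f y) (f x), hM y hy, hM x (mem_ball_self hr)]

/-- A Cauchy estimate for the first order Taylor remainder of a bounded holomorphic function. -/
theorem norm_sub_sub_fderiv_le_of_norm_le_on_ball {f : X → Y} (hr : 0 < r)
    (hd : DifferentiableOn ℂ f (ball x r)) (hM : ∀ y ∈ ball x r, ‖f y‖ ≤ M) {h : X}
    (hh : ‖h‖ < r) :
    ‖f (x + h) - f x - fderiv ℂ f x h‖ ≤ 4 * M * (‖h‖ / r) ^ 2 := by
  have hmem : ∀ {k : X}, ‖k‖ < r → x + k ∈ ball x r := fun {k} hk => by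
    simpa [mem_ball, dist_eq_norm] using hk
  have hder : HasFDerivAt f (fderiv ℂ f x) x :=
    ((hd x (mem_ball_self hr)).differentiableAt (ball_mem_nhds x hr)).hasFDerivAt
  -- Without its linear part, `f (x + ·)` differs from its value at `0` by `o(‖k‖)`, so the Schwarz
  -- lemma for higher order vanishing yields the quadratic factor. The constant `4 * M` is `2 * M`
  -- for the increment of `f` plus `2 * M` for the derivative term.
  set g : X → Y := fun k => f (x + k) - fderiv ℂ f x k with hg
  have hgd : DifferentiableOn ℂ g (ball 0 r) := by
    refine DifferentiableOn.sub ?_ (fderiv ℂ f x).differentiable.differentiableOn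
    refine hd.comp (by fun_prop) fun k hk => hmem (by simpa using hk)
  have hg0 : ∀ k, g k - g 0 = f (x + k) - f x - fderiv ℂ f x k := fun k => by
    simp only [hg, add_zero, map_zero, sub_zero]
    abel
  have hmaps : Set.MapsTo g (ball 0 r) (closedBall (g 0) (4 * M)) := by
    intro k hk
    have hk' : ‖k‖ < r := by simpa using hk
    rw [mem_closedBall, dist_eq_norm, hg0]
    have h1 : ‖fderiv ℂ f x k‖ ≤ 2 * M := by
      refine ((fderiv ℂ f x).le_opNorm_of_le hk'.le).trans ?_
      have := norm_fderiv_le_of_norm_le_on_ball hr hd hM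
      rwa [le_div_iff₀ hr] at this
    have h2 := norm_sub_le (f (x + k) - f x) (fderiv ℂ f x k)
    have h3 := norm_sub_le (f (x + k)) (f x)
    linarith [hM _ (hmem hk'), hM x (mem_ball_self hr)]
  have hlit : (fun k => g k - g 0) =o[𝓝 (0 : X)] fun k => ‖k - 0‖ ^ 1 := by
    simp only [hg0, sub_zero, pow_one]
    exact (hasFDerivAt_iff_isLittleO_nhds_zero.1 hder).norm_right
  have := Complex.dist_le_mul_div_pow_of_mapsTo_ball_of_isLittleO (z := h) hgd hmaps hlit (by simpa using hh)
  rwa [dist_eq_norm, hg0, dist_zero_right] at this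

/-- A pointwise limit of locally uniformly bounded holomorphic functions is holomorphic. -/
theorem differentiableAt_of_tendsto_of_norm_le [CompleteSpace Y] {ι : Type*} {l : Filter ι}
    [l.NeBot] {f : ι → X → Y} {g : X → Y} (hr : 0 < r)
    (hd : ∀ i, DifferentiableOn ℂ (f i) (ball x r)) (hM : ∀ i, ∀ y ∈ ball x r, ‖f i y‖ ≤ M)
    (hfg : ∀ y ∈ ball x r, Tendsto (fun i => f i y) l (𝓝 (g y))) :
    DifferentiableAt ℂ g x := by
  have hmem : ∀ {k : X}, ‖k‖ < r → x + k ∈ ball x r := fun {k} hk => by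
    simpa [mem_ball, dist_eq_norm] using hk
  have htaylor := fun i => fun h (hh : ‖h‖ < r) =>
    norm_sub_sub_fderiv_le_of_norm_le_on_ball hr (hd i) (hM i) hh
  -- The difference quotients at a fixed step `t` converge, and by the Taylor estimate they are
  -- within `4 * M * t * (‖h‖ / r) ^ 2` of the derivatives, uniformly in `i`. So the derivatives are
  -- Cauchy along `l`.
  have hcauchy : ∀ h : X, ∃ y, Tendsto (fun i => fderiv ℂ (f i) x h) l (𝓝 y) := by
    intro h
    refine cauchy_map_iff_exists_tendsto.1 (Metric.cauchy_iff.2 ⟨inferInstance, fun ε hε => ?_⟩)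
    have hsmall : ∀ᶠ t : ℝ in 𝓝[>] 0, t * ‖h‖ < r ∧ 4 * M * t * (‖h‖ / r) ^ 2 < ε / 4 := by
      refine Filter.Eventually.filter_mono nhdsWithin_le_nhds (Filter.Eventually.and ?_ ?_)
      · exact ContinuousAt.eventually_lt (by fun_prop) continuousAt_const (by simpa using hr)
      · exact ContinuousAt.eventually_lt (by fun_prop) continuousAt_const (by simpa using hε)
    obtain ⟨t, ⟨ht1, ht2⟩, ht0⟩ := (hsmall.and self_mem_nhdsWithin).exists
    have ht0 : 0 < t := ht0
    have hnorm : ‖(t : ℂ) • h‖ = t * ‖h‖ := by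
      rw [norm_smul, Complex.norm_real, Real.norm_of_nonneg ht0.le]
    have hq : Tendsto (fun i => f i (x + (t : ℂ) • h) - f i x) l
        (𝓝 (g (x + (t : ℂ) • h) - g x)) :=
      (hfg _ (hmem (hnorm ▸ ht1))).sub (hfg _ (mem_ball_self hr))
    have hev := Metric.tendsto_nhds.1 hq (t * (ε / 4)) (by positivity)
    refine ⟨_, image_mem_map hev, ?_⟩
    have hclose : ∀ i, dist (f i (x + (t : ℂ) • h) - f i x) (g (x + (t : ℂ) • h) - g x)
        < t * (ε / 4) →
        ‖(t : ℂ) • fderiv ℂ (f i) x h - (g (x + (t : ℂ) • h) - g x)‖ < t * (ε / 2) := by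
      intro i hi
      have h1 := htaylor i ((t : ℂ) • h) (hnorm ▸ ht1)
      rw [map_smul, hnorm] at h1
      have h2 : 4 * M * (t * ‖h‖ / r) ^ 2 = t * (4 * M * t * (‖h‖ / r) ^ 2) := by ring
      have h3 : 4 * M * (t * ‖h‖ / r) ^ 2 < t * (ε / 4) := by
        rw [h2]
        exact mul_lt_mul_of_pos_left ht2 ht0
      rw [dist_eq_norm] at hi
      have h4 := norm_sub_le_norm_sub_add_norm_sub ((t : ℂ) • fderiv ℂ (f i) x h)
        (f i (x + (t : ℂ) • h) - f i x) (g (x + (t : ℂ) • h) - g x)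
      rw [norm_sub_rev] at h1
      linarith
    rintro _ ⟨i, hi, rfl⟩ _ ⟨j, hj, rfl⟩
    have h1 := hclose i hi
    have h2 := hclose j hj
    have h3 := norm_sub_le_norm_sub_add_norm_sub ((t : ℂ) • fderiv ℂ (f i) x h)
      (g (x + (t : ℂ) • h) - g x) ((t : ℂ) • fderiv ℂ (f j) x h)
    rw [norm_sub_rev (g (x + (t : ℂ) • h) - g x), ← smul_sub, norm_smul, Complex.norm_real,
      Real.norm_of_nonneg ht0.le] at h3
    rw [dist_eq_norm]
    exact lt_of_mul_lt_mul_left (by linarith) ht0.le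
  choose L hL using hcauchy
  let D : X →L[ℂ] Y := ContinuousLinearMap.ofTendstoOfBoundedRange L (fun i => fderiv ℂ (f i) x)
    (tendsto_pi_nhds.2 hL) (isBounded_iff_forall_norm_le.2 ⟨2 * M / r, by
      rintro _ ⟨i, rfl⟩
      exact norm_fderiv_le_of_norm_le_on_ball hr (hd i) (hM i)⟩)
  -- The Taylor bound is uniform in `i`, so it survives the limit and identifies `D` as the
  -- derivative of `g`.
  have hD : ∀ h, ‖h‖ < r → ‖g (x + h) - g x - D h‖ ≤ 4 * M * (‖h‖ / r) ^ 2 := by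
    intro h hh
    refine le_of_tendsto (((hfg _ (hmem hh)).sub (hfg _ (mem_ball_self hr))).sub (hL h)).norm
      (Eventually.of_forall fun i => htaylor i h hh)
  refine HasFDerivAt.differentiableAt (f' := D) (hasFDerivAt_iff_isLittleO_nhds_zero.2 ?_)
  have hO : (fun h => g (x + h) - g x - D h) =O[𝓝 0] fun h => ‖h‖ ^ 2 := by
    refine Asymptotics.IsBigO.of_bound (4 * M / r ^ 2) ?_
    filter_upwards [ball_mem_nhds (0 : X) hr] with h hh
    refine (hD h (by simpa using hh)).trans_eq ?_
    rw [Real.norm_of_nonneg (by positivity)]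
    ring
  exact hO.trans_isLittleO (Asymptotics.isLittleO_norm_pow_id one_lt_two)

end BoundedLimits

/-! ### Locally uniform square summability of the monomials. -/

theorem sum_norm_sq_le_norm_sq {ι : Type*} {X : Type*} [NormedAddCommGroup X]
    (f : lp (fun _ : ι => X) 2) (s : Finset ι) : ∑ i ∈ s, ‖f i‖ ^ 2 ≤ ‖f‖ ^ 2 := by
  have := lp.sum_rpow_le_norm_rpow (p := 2) (by norm_num) f s
  simpa using this

/-- The sum is dominated by the Euler product `∏ (1 - ‖ζ n‖²)⁻¹`, and each factor by an exponential.
The point is that the bound depends on `ζ` only through `p` and `‖ζ‖`, hence is uniform on small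
balls. -/
theorem sum_norm_monomial_sq_le {ζ : EllTwo} {p : ℝ} (hp : p < 1) (hζ : ∀ n, ‖ζ n‖ ≤ p)
    (u : Finset MultiIndex) :
    ∑ α ∈ u, ‖monomial ζ α‖ ^ 2 ≤ Real.exp (‖ζ‖ ^ 2 / (1 - p ^ 2)) := by
  have hp0 : 0 ≤ p := (norm_nonneg _).trans (hζ 0)
  have hp2 : 0 < 1 - p ^ 2 := by nlinarith
  set r : ℕ → ℝ := fun n => ‖ζ n‖ ^ 2 with hr
  have hr0 : ∀ n, 0 ≤ r n := fun n => by positivity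
  have hrp : ∀ n, r n ≤ p ^ 2 := fun n => pow_le_pow_left₀ (norm_nonneg _) (hζ n) 2
  have hr1 : ∀ n, r n < 1 := fun n => by linarith [hrp n]
  have hmon : ∀ α, ‖monomial ζ α‖ ^ 2 = α.prod fun n k => r n ^ k := by
    intro α
    simp only [monomial, Finsupp.prod, norm_prod, norm_pow, hr, ← Finset.prod_pow]
    exact Finset.prod_congr rfl fun n _ => by ring
  set s : Finset ℕ := u.sup Finsupp.support with hs
  -- `K` exceeds every exponent occurring in `u`, so `u` lies in a finite box over which the sum
  -- factorizes.
  set K : ℕ := (u.sup fun α => s.sup α) + 1 with hK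
  have hsub : u ⊆ s.finsupp fun _ => Finset.range K := by
    intro α hα
    rw [Finset.mem_finsupp_iff]
    have h1 : α.support ⊆ s := Finset.le_sup (f := Finsupp.support) hα
    refine ⟨h1, fun n hn => ?_⟩
    have h2 : α n ≤ s.sup α := Finset.le_sup (f := α) hn
    have h3 : s.sup α ≤ u.sup fun α => s.sup α :=
      Finset.le_sup (f := fun α : MultiIndex => s.sup α) hα
    rw [Finset.mem_range]
    omega
  calc ∑ α ∈ u, ‖monomial ζ α‖ ^ 2
      ≤ ∑ α ∈ s.finsupp fun _ => Finset.range K, ‖monomial ζ α‖ ^ 2 :=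
        Finset.sum_le_sum_of_subset_of_nonneg hsub fun _ _ _ => by positivity
    _ = ∏ n ∈ s, ∑ k ∈ Finset.range K, r n ^ k := by
        rw [Finset.prod_sum, Finset.finsupp, Finset.sum_map]
        refine Finset.sum_congr (by congr!) fun q _ => ?_
        rw [hmon, Finsupp.prod_of_support_subset (s := s)]
        · rw [← Finset.prod_attach]
          refine Finset.prod_congr rfl fun n _ => ?_
          simp [Finsupp.indicator_apply]
        · simpa using Finsupp.support_indicator_subset _ _
        · intros; simp
    _ ≤ ∏ n ∈ s, Real.exp (r n / (1 - p ^ 2)) := by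
        refine Finset.prod_le_prod
          (fun n _ => Finset.sum_nonneg fun k _ => pow_nonneg (hr0 n) k) fun n _ => ?_
        have h1 : ∑ k ∈ Finset.range K, r n ^ k ≤ (1 - r n)⁻¹ := by
          rw [← tsum_geometric_of_lt_one (hr0 n) (hr1 n)]
          exact (summable_geometric_of_lt_one (hr0 n) (hr1 n)).sum_le_tsum _
            fun k _ => pow_nonneg (hr0 n) k
        have h2 : (1 - r n)⁻¹ = r n / (1 - r n) + 1 := by
          have : 1 - r n ≠ 0 := by linarith [hr1 n]
          field_simp
          ring
        have h3 : r n / (1 - r n) ≤ r n / (1 - p ^ 2) :=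
          div_le_div_of_nonneg_left (hr0 n) hp2 (by linarith [hrp n])
        exact h1.trans ((h2.trans_le (by linarith)).trans (Real.add_one_le_exp _))
    _ = Real.exp (∑ n ∈ s, r n / (1 - p ^ 2)) := (Real.exp_sum _ _).symm
    _ ≤ _ := by
        rw [← Finset.sum_div]
        gcongr
        exact sum_norm_sq_le_norm_sq ζ s

/-- Coordinates of an `ℓ²` sequence tend to zero, so all but finitely many are below `1 / 2` in
modulus. This uniform gap from `1` makes the multidisk open. -/
theorem exists_norm_le_of_mem_multidisk {ζ : EllTwo} (hζ : ζ ∈ multidisk) :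
    ∃ q < 1, ∀ n, ‖ζ n‖ ≤ q := by
  have hs : Summable fun n => ‖ζ n‖ ^ 2 := by
    have := (lp.memℓp ζ).summable (by norm_num)
    simpa using this
  have hfin : {n | ¬ ‖ζ n‖ ^ 2 < 1 / 4}.Finite :=
    hs.tendsto_cofinite_zero.eventually (gt_mem_nhds (by norm_num))
  have h1 : ∀ᶠ q in 𝓝[<] (1 : ℝ), ∀ n ∈ {n | ¬ ‖ζ n‖ ^ 2 < 1 / 4}, ‖ζ n‖ < q :=
    (eventually_all_finite hfin).2 fun n _ => nhdsWithin_le_nhds (lt_mem_nhds (hζ n))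
  have h2 : ∀ᶠ q in 𝓝[<] (1 : ℝ), 1 / 2 < q := nhdsWithin_le_nhds (lt_mem_nhds (by norm_num))
  obtain ⟨q, ⟨hq1, hq2⟩, hq3⟩ := ((h1.and h2).and self_mem_nhdsWithin).exists
  refine ⟨q, hq3, fun n => ?_⟩
  by_cases hn : ‖ζ n‖ ^ 2 < 1 / 4
  · nlinarith [norm_nonneg (ζ n)]
  · exact (hq1 n hn).le

/-- The monomials are locally uniformly square summable on the multidisk. -/
theorem exists_ball_sum_norm_monomial_sq_le {ξ : EllTwo} (hξ : ξ ∈ multidisk) :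
    ∃ r > 0, ∃ M : ℝ, ball ξ r ⊆ multidisk ∧
      ∀ ζ ∈ ball ξ r, ∀ u : Finset MultiIndex, ∑ α ∈ u, ‖monomial ζ α‖ ^ 2 ≤ M := by
  obtain ⟨q, hq, hξq⟩ := exists_norm_le_of_mem_multidisk hξ
  have hq0 : 0 ≤ q := (norm_nonneg _).trans (hξq 0)
  have key : ∀ ζ ∈ ball ξ ((1 - q) / 2), ∀ n, ‖ζ n‖ ≤ (1 + q) / 2 := by
    intro ζ hζ n
    rw [mem_ball, dist_eq_norm] at hζ
    have h1 : ‖ζ n - ξ n‖ ≤ ‖ζ - ξ‖ := lp.norm_apply_le_norm (by norm_num) (ζ - ξ) n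
    have h2 := norm_sub_norm_le (ζ n) (ξ n)
    linarith [hξq n]
  refine ⟨(1 - q) / 2, by linarith, Real.exp ((‖ξ‖ + 1) ^ 2 / (1 - ((1 + q) / 2) ^ 2)),
    fun ζ hζ n => (key ζ hζ n).trans_lt (by linarith), fun ζ hζ u => ?_⟩
  refine (sum_norm_monomial_sq_le (by linarith) (key ζ hζ) u).trans ?_
  have h1 : ‖ζ‖ ≤ ‖ξ‖ + 1 := by
    rw [mem_ball, dist_eq_norm] at hζ
    linarith [norm_sub_norm_le ζ ξ]
  have h2 : 0 ≤ 1 - ((1 + q) / 2) ^ 2 := by nlinarith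
  gcongr

theorem differentiable_monomial (α : MultiIndex) :
    Differentiable ℂ fun ζ : EllTwo => monomial ζ α := by
  intro ζ
  have h : ∀ n ∈ α.support, DifferentiableAt ℂ (fun ζ : EllTwo => ζ n ^ α n) ζ := fun n _ =>
    DifferentiableAt.fun_pow
      (lp.evalCLM ℂ (fun _ : ℕ => ℂ) 2 n).differentiableAt _
  exact (HasFDerivAt.finsetProd fun n hn => (h n hn).hasFDerivAt).differentiableAt

/-! ### Monomial series with coefficients in a Banach space. -/

section MonomialSeries

variable {Y : Type*} [NormedAddCommGroup Y] [NormedSpace ℂ Y] [CompleteSpace Y]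
  {C : MultiIndex → Y}

/-- The hypothesis `hC` bounds the map `c ↦ ∑ c α • C α` on `ℓ²`, so square summability of the
monomials gives the Cauchy criterion. Mere boundedness of the `C α` would not allow absolute
convergence, since `∑ ‖ζ n‖` may diverge. -/
theorem summable_monomial_smul
    (hC : ∀ (c : MultiIndex → ℂ) (s : Finset MultiIndex),
      ‖∑ α ∈ s, c α • C α‖ ≤ √(∑ α ∈ s, ‖c α‖ ^ 2))
    {ζ : EllTwo} (hζ : ζ ∈ multidisk) :
    Summable fun α => monomial ζ α • C α := by
  refine summable_iff_vanishing_norm.2 fun ε hε => ?_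
  obtain ⟨s, hs⟩ := summable_iff_vanishing_norm.1 (summable_norm_monomial_sq hζ) (ε ^ 2)
    (by positivity)
  refine ⟨s, fun t ht => (hC _ t).trans_lt ?_⟩
  rw [Real.sqrt_lt' hε]
  exact (Real.le_norm_self _).trans_lt (hs t ht)

theorem norm_tsum_monomial_smul_le
    (hC : ∀ (c : MultiIndex → ℂ) (s : Finset MultiIndex),
      ‖∑ α ∈ s, c α • C α‖ ≤ √(∑ α ∈ s, ‖c α‖ ^ 2))
    {ζ : EllTwo} (hζ : ζ ∈ multidisk) :
    ‖∑' α, monomial ζ α • C α‖ ≤ √(∑' α, ‖monomial ζ α‖ ^ 2) := by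
  have h : Tendsto (fun s => ∑ α ∈ s, monomial ζ α • C α) atTop (𝓝 (∑' α, monomial ζ α • C α)) :=
    (summable_monomial_smul hC hζ).hasSum
  refine le_of_tendsto h.norm (Eventually.of_forall fun s => (hC _ s).trans ?_)
  exact Real.sqrt_le_sqrt ((summable_norm_monomial_sq hζ).sum_le_tsum _ fun _ _ => by positivity)

theorem differentiableOn_tsum_monomial_smul
    (hC : ∀ (c : MultiIndex → ℂ) (s : Finset MultiIndex),
      ‖∑ α ∈ s, c α • C α‖ ≤ √(∑ α ∈ s, ‖c α‖ ^ 2)) :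
    DifferentiableOn ℂ (fun ζ => ∑' α, monomial ζ α • C α) multidisk := by
  intro ξ hξ
  obtain ⟨r, hr, M, hsub, hM⟩ := exists_ball_sum_norm_monomial_sq_le hξ
  refine (differentiableAt_of_tendsto_of_norm_le (l := atTop) (M := √M)
    (f := fun (s : Finset MultiIndex) ζ => ∑ α ∈ s, monomial ζ α • C α) hr ?_ ?_
    fun ζ hζ => (summable_monomial_smul hC (hsub hζ)).hasSum).differentiableWithinAt
  · intro s
    refine (Differentiable.fun_sum fun α _ => ?_).differentiableOn
    exact (differentiable_monomial α).smul_const _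
  · exact fun s ζ hζ => (hC _ s).trans (Real.sqrt_le_sqrt (hM ζ hζ s))

end MonomialSeries

/-! ### Evaluation operators and their holomorphic dependence on the point. -/

section

variable {E : Type*} [NormedAddCommGroup E] [InnerProductSpace ℂ E]
  {H : Type*} [NormedAddCommGroup H] [InnerProductSpace ℂ H]

/-- The `α`-th coefficient of elements of a space that is embedded into the Hardy space. -/
def coeffCLM (V : H →ₗᵢ[ℂ] HardySpace E) (α : MultiIndex) : H →L[ℂ] E :=
  (lp.evalCLM ℂ (fun _ : MultiIndex => E) 2 α).comp V.toContinuousLinearMap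

/-- Cauchy–Schwarz against the coefficients of `V f`, whose `ℓ²` norm is `‖f‖`. This is the
hypothesis `hC` of the monomial series lemmas. -/
theorem norm_sum_smul_coeffCLM_le (V : H →ₗᵢ[ℂ] HardySpace E) (c : MultiIndex → ℂ)
    (s : Finset MultiIndex) :
    ‖∑ α ∈ s, c α • coeffCLM V α‖ ≤ √(∑ α ∈ s, ‖c α‖ ^ 2) := by
  refine ContinuousLinearMap.opNorm_le_bound _ (Real.sqrt_nonneg _) fun f => ?_
  rw [_root_.sum_apply]
  calc ‖∑ α ∈ s, (c α • coeffCLM V α) f‖ ≤ ∑ α ∈ s, ‖c α‖ * ‖V f α‖ :=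
        norm_sum_le_of_le _ fun α _ => (norm_smul _ _).le
    _ ≤ √(∑ α ∈ s, ‖c α‖ ^ 2) * √(∑ α ∈ s, ‖V f α‖ ^ 2) := Real.sum_mul_le_sqrt_mul_sqrt _ _ _
    _ ≤ _ := by
        rw [← V.norm_map f]
        gcongr
        exact Real.sqrt_le_left (norm_nonneg _) |>.2 (sum_norm_sq_le_norm_sq (V f) s)

/-- Evaluation at a point of elements of a space that is embedded into the Hardy space, as a
bounded operator; see `evalCLM_apply`. -/
def evalCLM (V : H →ₗᵢ[ℂ] HardySpace E) (ζ : EllTwo) : H →L[ℂ] E :=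
  ∑' α, monomial ζ α • coeffCLM V α

variable [CompleteSpace E] (V : H →ₗᵢ[ℂ] HardySpace E)

theorem evalCLM_apply {ζ : EllTwo} (hζ : ζ ∈ multidisk) (f : H) :
    evalCLM V ζ f = (V f).eval ζ :=
  (ContinuousLinearMap.apply ℂ E f).map_tsum
    (summable_monomial_smul (norm_sum_smul_coeffCLM_le V) hζ)

theorem norm_evalCLM_le {ζ : EllTwo} (hζ : ζ ∈ multidisk) :
    ‖evalCLM V ζ‖ ≤ √(∑' α, ‖monomial ζ α‖ ^ 2) :=
  norm_tsum_monomial_smul_le (norm_sum_smul_coeffCLM_le V) hζ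

theorem differentiableOn_evalCLM : DifferentiableOn ℂ (evalCLM V) multidisk :=
  differentiableOn_tsum_monomial_smul (norm_sum_smul_coeffCLM_le V)

theorem norm_eval_le {ζ : EllTwo} (hζ : ζ ∈ multidisk) (F : HardySpace E) :
    ‖F.eval ζ‖ ≤ √(∑' α, ‖monomial ζ α‖ ^ 2) * ‖F‖ := by
  have h := evalCLM_apply (LinearIsometry.id (R := ℂ) (E := HardySpace E)) hζ F
  rw [LinearIsometry.id_apply] at h
  rw [← h]
  exact ContinuousLinearMap.le_of_opNorm_le _ (norm_evalCLM_le _ hζ) F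

theorem hasSum_eval {ι : Type*} {f : ι → HardySpace E} {F : HardySpace E} (h : HasSum f F)
    {ζ : EllTwo} (hζ : ζ ∈ multidisk) : HasSum (fun i => (f i).eval ζ) (F.eval ζ) := by
  have := h.mapL (evalCLM (LinearIsometry.id (R := ℂ) (E := HardySpace E)) ζ)
  simpa only [evalCLM_apply _ hζ, LinearIsometry.id_apply] using this

end

/-! ### Wold decomposition for doubly commuting isometries. -/

section Wold

open ContinuousLinearMap (adjoint)

variable {H : Type*} [NormedAddCommGroup H] [InnerProductSpace ℂ H] [CompleteSpace H]

/-- The wandering subspace `⋂ n, ker (R n)*` of a sequence of operators. -/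
def wanderingSubspace (R : ℕ → H →L[ℂ] H) : Submodule ℂ H :=
  ⨅ n, (adjoint (R n)).ker

theorem mem_wanderingSubspace {R : ℕ → H →L[ℂ] H} {w : H} :
    w ∈ wanderingSubspace R ↔ ∀ n, adjoint (R n) w = 0 := by
  simp [wanderingSubspace]

theorem isClosed_wanderingSubspace (R : ℕ → H →L[ℂ] H) :
    IsClosed (wanderingSubspace R : Set H) := by
  rw [wanderingSubspace, Submodule.coe_iInf]
  exact isClosed_iInter fun n => (adjoint (R n)).isClosed_ker

instance (R : ℕ → H →L[ℂ] H) : CompleteSpace (wanderingSubspace R) :=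
  (isClosed_wanderingSubspace R).completeSpace_coe

/-- `A α` is the product of the powers `R n ^ α n`. -/
structure IsMonomialFamily (R : ℕ → H →L[ℂ] H) (A : MultiIndex → H →ₗᵢ[ℂ] H) : Prop where
  zero : ∀ f, A 0 f = f
  add_single : ∀ α n f, A (α + Finsupp.single n 1) f = R n (A α f)

variable {R : ℕ → H →L[ℂ] H} {A : MultiIndex → H →ₗᵢ[ℂ] H}

theorem exists_eq_add_single {α : MultiIndex} {n : ℕ} (h : α n ≠ 0) :
    ∃ β : MultiIndex, α = β + Finsupp.single n 1 :=
  ⟨α - Finsupp.single n 1, (tsub_add_cancel_of_le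
    (Finsupp.single_le_iff.2 (Nat.one_le_iff_ne_zero.2 h))).symm⟩

/-- Only factors `R m` with `m ≠ n` occur in `A α`; the adjoint of `R n` commutes past each of them
and then kills `w`. -/
theorem adjoint_apply_monomial_eq_zero (hR : DoublyCommuting R) (hA : IsMonomialFamily R A)
    {w : H} (hw : w ∈ wanderingSubspace R) {α : MultiIndex} {n : ℕ} (hα : α n = 0) :
    adjoint (R n) (A α w) = 0 := by
  induction h : α.degree generalizing α with
  | zero =>
    rw [(Finsupp.degree_eq_zero_iff α).1 h, hA.zero]
    exact mem_wanderingSubspace.1 hw n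
  | succ k ih =>
    have hα0 : α ≠ 0 := by
      rintro rfl
      simp at h
    obtain ⟨m, hm⟩ := Finsupp.ne_iff.1 hα0
    obtain ⟨β, rfl⟩ := exists_eq_add_single hm
    have hmn : n ≠ m := by
      rintro rfl
      simp at hα
    have hβ : adjoint (R n) (A β w) = 0 := by
      refine ih ?_ ?_
      · simpa [hmn.symm] using hα
      · simpa [map_add] using h
    have := DFunLike.congr_fun (hR n m hmn).2 (A β w)
    simp only [ContinuousLinearMap.comp_apply] at this
    rw [hA.add_single, this, hβ, map_zero]

theorem adjoint_apply_self_of_isometry {T : H →L[ℂ] H} (hT : ∀ f, ‖T f‖ = ‖f‖) (f : H) :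
    adjoint T (T f) = f :=
  DFunLike.congr_fun ((ContinuousLinearMap.norm_map_iff_adjoint_comp_self T).1 hT) f

/-- Common factors `R n` cancel because `R n` is an isometry. Once `α n` reaches `0`, a factor `R n`
remains on the other side, and its adjoint annihilates `A α w`. Only `w` has to be wandering. -/
theorem inner_monomial_eq_zero_of_lt (hR : DoublyCommuting R) (hiso : ∀ n f, ‖R n f‖ = ‖f‖)
    (hA : IsMonomialFamily R A) {w w' : H} (hw : w ∈ wanderingSubspace R) {n : ℕ} :
    ∀ {α β : MultiIndex}, α n < β n → inner ℂ (A β w') (A α w) = 0 := by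
  intro α
  induction h : α n generalizing α with
  | zero =>
    intro β hβ
    obtain ⟨β', rfl⟩ := exists_eq_add_single hβ.ne'
    rw [hA.add_single, ← ContinuousLinearMap.adjoint_inner_right,
      adjoint_apply_monomial_eq_zero hR hA hw h, inner_zero_right]
  | succ k ih =>
    intro β hβ
    obtain ⟨β', rfl⟩ := exists_eq_add_single (by omega : β n ≠ 0)
    obtain ⟨α', rfl⟩ := exists_eq_add_single (by omega : α n ≠ 0)
    rw [hA.add_single, hA.add_single, ← ContinuousLinearMap.adjoint_inner_right,
      adjoint_apply_self_of_isometry (hiso n)]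
    refine ih ?_ ?_
    · simpa using h
    · simpa using hβ

theorem orthogonalFamily_monomial (hR : DoublyCommuting R) (hiso : ∀ n f, ‖R n f‖ = ‖f‖)
    (hA : IsMonomialFamily R A) :
    OrthogonalFamily ℂ (fun _ : MultiIndex => wanderingSubspace R)
      fun α => (A α).comp (wanderingSubspace R).subtypeₗᵢ := by
  intro α β hαβ v w
  obtain ⟨n, hn⟩ := Finsupp.ne_iff.1 hαβ
  rcases hn.lt_or_gt with hn | hn
  · rw [← inner_conj_symm]
    refine (congrArg _ ?_).trans (map_zero _)
    exact inner_monomial_eq_zero_of_lt hR hiso hA v.2 hn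
  · exact inner_monomial_eq_zero_of_lt hR hiso hA w.2 hn

/-- The Wold decomposition of a doubly commuting sequence of isometries that raise the degree of
a separating filtration by closed subspaces. -/
theorem iSup_range_monomial_topologicalClosure_eq_top (hR : DoublyCommuting R)
    (hiso : ∀ n f, ‖R n f‖ = ‖f‖) (hA : IsMonomialFamily R A) (Z : ℕ → Submodule ℂ H)
    (hZc : ∀ k, IsClosed (Z k : Set H)) (hZ0 : Z 0 = ⊤)
    (hZR : ∀ k n, ∀ f ∈ Z k, R n f ∈ Z (k + 1)) (hZ : ⨅ k, Z k = ⊥) :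
    (⨆ α, ((A α).comp (wanderingSubspace R).subtypeₗᵢ).range).topologicalClosure = ⊤ := by
  rw [Submodule.topologicalClosure_eq_top_iff, ← Submodule.iInf_orthogonal]
  set K : Submodule ℂ H := ⨅ α, ((A α).comp (wanderingSubspace R).subtypeₗᵢ).rangeᗮ with hK
  have hmem : ∀ f, f ∈ K ↔ ∀ α, ∀ w ∈ wanderingSubspace R, inner ℂ (A α w) f = 0 := by
    intro f
    simp [hK, Submodule.mem_iInf, Submodule.mem_orthogonal]
  have hKc : IsClosed (K : Set H) := by
    rw [hK, Submodule.coe_iInf]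
    exact isClosed_iInter fun α => Submodule.isClosed_orthogonal _
  have hKR : ∀ n, ∀ f ∈ K, R n f ∈ K := by
    intro n f hf
    refine (hmem _).2 fun α w hw => ?_
    rw [← ContinuousLinearMap.adjoint_inner_left]
    by_cases hα : α n = 0
    · rw [adjoint_apply_monomial_eq_zero hR hA hw hα, inner_zero_left]
    · obtain ⟨β, rfl⟩ := exists_eq_add_single hα
      rw [hA.add_single, adjoint_apply_self_of_isometry (hiso n)]
      exact (hmem f).1 hf β w hw
  have hKR' : ∀ n, ∀ f ∈ K, adjoint (R n) f ∈ K := by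
    intro n f hf
    refine (hmem _).2 fun α w hw => ?_
    rw [ContinuousLinearMap.adjoint_inner_right, ← hA.add_single]
    exact (hmem f).1 hf _ w hw
  -- `K` is the orthogonal complement of the span and reduces every `R n`. For the induction step,
  -- let `q` be the part of `f` orthogonal to `K ⊓ Z (k + 1)`. Then `R n (R n)* q` lies in that
  -- subspace, so pairing it with `q` gives `‖(R n)* q‖² = 0`. Thus `q` is wandering, and membership
  -- in `K` at `α = 0` makes it orthogonal to itself.
  have hKZ : ∀ k, K ≤ Z k := by
    intro k
    induction k with
    | zero => exact hZ0 ▸ le_top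
    | succ k ih =>
      intro f hf
      have : CompleteSpace (K ⊓ Z (k + 1) : Submodule ℂ H) :=
        (hKc.inter (hZc (k + 1))).completeSpace_coe
      obtain ⟨p, hp, q, hq, rfl⟩ :=
        Submodule.exists_add_mem_mem_orthogonal (K := K ⊓ Z (k + 1)) f
      have hqK : q ∈ K := (Submodule.add_mem_iff_right _ hp.1).1 hf
      have hqW : q ∈ wanderingSubspace R := by
        refine mem_wanderingSubspace.2 fun n => ?_
        have h1 := hKR' n q hqK
        have h2 := Submodule.inner_right_of_mem_orthogonal
          (K := K ⊓ Z (k + 1)) ⟨hKR n _ h1, hZR k n _ (ih h1)⟩ hq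
        rwa [← ContinuousLinearMap.adjoint_inner_right, inner_self_eq_zero] at h2
      have hq0 : q = 0 := by
        have := (hmem q).1 hqK 0 q hqW
        rwa [hA.zero, inner_self_eq_zero] at this
      rw [hq0, add_zero]
      exact hp.2
  exact le_bot_iff.1 (hZ ▸ le_iInf hKZ)

/-- The Wold decomposition, with the wandering subspace as an abstract Hilbert space. -/
theorem exists_orthogonalFamily_monomial {H : Type u} [NormedAddCommGroup H]
    [InnerProductSpace ℂ H] [CompleteSpace H] {R : ℕ → H →L[ℂ] H} {A : MultiIndex → H →ₗᵢ[ℂ] H}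
    (hR : DoublyCommuting R) (hiso : ∀ n f, ‖R n f‖ = ‖f‖) (hA : IsMonomialFamily R A)
    (Z : ℕ → Submodule ℂ H) (hZc : ∀ k, IsClosed (Z k : Set H)) (hZ0 : Z 0 = ⊤)
    (hZR : ∀ k n, ∀ f ∈ Z k, R n f ∈ Z (k + 1)) (hZ : ⨅ k, Z k = ⊥) :
    ∃ (W : Type u) (_ : NormedAddCommGroup W) (_ : InnerProductSpace ℂ W) (_ : CompleteSpace W)
      (j : W →ₗᵢ[ℂ] H), OrthogonalFamily ℂ (fun _ : MultiIndex => W) (fun α => (A α).comp j) ∧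
        (⨆ α, ((A α).comp j).range).topologicalClosure = ⊤ :=
  ⟨wanderingSubspace R, inferInstance, inferInstance, inferInstance,
    (wanderingSubspace R).subtypeₗᵢ, orthogonalFamily_monomial hR hiso hA,
    iSup_range_monomial_topologicalClosure_eq_top hR hiso hA Z hZc hZ0 hZR hZ⟩

end Wold

/-! ### Isometric multiplication operators. -/

section Multiplication

variable {E : Type*} [NormedAddCommGroup E] [InnerProductSpace ℂ E] [CompleteSpace E]
  {F : Type*} [NormedAddCommGroup F] [InnerProductSpace ℂ F]
  {Ψ : EllTwo → F →L[ℂ] E} {T : HardySpace F →L[ℂ] HardySpace E}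

theorem IsMultiplicationOperator.mulImage_eq_range (hT : IsMultiplicationOperator Ψ T) :
    mulImage Ψ = Set.range T := by
  ext H
  refine ⟨fun ⟨G, hG⟩ => ⟨G, HardySpace.eval_injective fun ζ hζ => ?_⟩, ?_⟩
  · rw [hT G ζ hζ, hG ζ hζ]
  · rintro ⟨G, rfl⟩
    exact ⟨G, fun ζ hζ => hT G ζ hζ⟩

/-- A multiplier that acts isometrically is contractive at every point; the proof tests it on a
vector multiple of the Szegő kernel. -/
theorem IsMultiplicationOperator.norm_le_one (hT : IsMultiplicationOperator Ψ T)
    (hiso : ∀ G, ‖T G‖ = ‖G‖) {ζ : EllTwo} (hζ : ζ ∈ multidisk) : ‖Ψ ζ‖ ≤ 1 := by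
  refine ContinuousLinearMap.opNorm_le_bound _ zero_le_one fun w => ?_
  rw [one_mul]
  have hs := summable_norm_monomial_sq hζ
  set K : ℝ := ∑' α, ‖monomial ζ α‖ ^ 2 with hK
  have hK0 : 0 < K := hs.tsum_pos (fun α => by positivity) 0 (by simp [monomial])
  have hnorm : ∀ α, ‖(starRingEnd ℂ (monomial ζ α)) • w‖ ^ 2 = ‖monomial ζ α‖ ^ 2 * ‖w‖ ^ 2 :=
    fun α => by rw [norm_smul, RCLike.norm_conj, mul_pow]
  let G : HardySpace F := ⟨fun α => (starRingEnd ℂ (monomial ζ α)) • w, by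
    refine memℓp_gen ?_
    refine (hs.mul_right (‖w‖ ^ 2)).congr fun α => ?_
    rw [← hnorm]
    norm_num⟩
  have hG : ‖G‖ = √K * ‖w‖ := by
    have h1 : ‖G‖ ^ 2 = K * ‖w‖ ^ 2 := by
      have h2 := lp.norm_rpow_eq_tsum (p := 2) (by norm_num) G
      have h3 : ‖G‖ ^ 2 = ∑' α, ‖G α‖ ^ 2 := by simpa using h2
      rw [h3, hK, ← tsum_mul_right]
      exact tsum_congr hnorm
    rw [← Real.sqrt_sq (norm_nonneg G), h1, Real.sqrt_mul hK0.le, Real.sqrt_sq (norm_nonneg w)]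
  have heval : G.eval ζ = (K : ℂ) • w := by
    have h1 : HasSum (fun α => ((‖monomial ζ α‖ ^ 2 : ℝ) : ℂ)) (K : ℂ) :=
      Complex.hasSum_ofReal.2 hs.hasSum
    rw [← (h1.smul_const w).tsum_eq, HardySpace.eval]
    refine tsum_congr fun α => ?_
    change monomial ζ α • (starRingEnd ℂ (monomial ζ α)) • w = _
    rw [smul_smul, RCLike.mul_conj]
    norm_cast
  -- Here `G` has norm `√K * ‖w‖` and value `K • w` at `ζ`; the evaluation bound contributes another
  -- `√K`, so the factors `K` cancel.
  have h1 := norm_eval_le hζ (T G)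
  rw [hT G ζ hζ, heval, map_smul, norm_smul, Complex.norm_real, Real.norm_of_nonneg hK0.le, hiso,
    hG, ← mul_assoc, ← hK, Real.mul_self_sqrt hK0.le] at h1
  exact le_of_mul_le_mul_left h1 hK0

end Multiplication

/-! ### From a doubly commuting submodule to an inner function. -/

section Submodule

variable {E : Type*} [NormedAddCommGroup E] [InnerProductSpace ℂ E]

theorem HardySubmodule.coe_restriction (S : HardySubmodule E) (n : ℕ) (f : S.toSubmodule) :
    (S.restriction n f : HardySpace E) = coordMul E n f := rfl

theorem HardySubmodule.norm_restriction (S : HardySubmodule E) (n : ℕ) (f : S.toSubmodule) :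
    ‖S.restriction n f‖ = ‖f‖ :=
  (coordMul E n).norm_map f

/-- Specifying the operator by its values makes the order of the factors irrelevant, so no ordered
product of the `R n` is needed. -/
theorem HardySubmodule.exists_monomialMul (S : HardySubmodule E) (α : MultiIndex) :
    ∃ A : S.toSubmodule →ₗᵢ[ℂ] S.toSubmodule, ∀ f ζ,
      HardySpace.eval (A f : HardySpace E) ζ = monomial ζ α • HardySpace.eval (f : HardySpace E) ζ := by
  have hadd : ∀ α β : MultiIndex,
      (∃ A : S.toSubmodule →ₗᵢ[ℂ] S.toSubmodule, ∀ f ζ, HardySpace.eval (A f : HardySpace E) ζ =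
        monomial ζ α • HardySpace.eval (f : HardySpace E) ζ) →
      (∃ A : S.toSubmodule →ₗᵢ[ℂ] S.toSubmodule, ∀ f ζ, HardySpace.eval (A f : HardySpace E) ζ =
        monomial ζ β • HardySpace.eval (f : HardySpace E) ζ) →
      ∃ A : S.toSubmodule →ₗᵢ[ℂ] S.toSubmodule, ∀ f ζ, HardySpace.eval (A f : HardySpace E) ζ =
        monomial ζ (α + β) • HardySpace.eval (f : HardySpace E) ζ := by
    rintro α β ⟨A, hA⟩ ⟨B, hB⟩
    refine ⟨A.comp B, fun f ζ => ?_⟩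
    change HardySpace.eval (A (B f) : HardySpace E) ζ = _
    rw [hA, hB, monomial_add, smul_smul]
  have hzero : ∃ A : S.toSubmodule →ₗᵢ[ℂ] S.toSubmodule, ∀ f ζ,
      HardySpace.eval (A f : HardySpace E) ζ =
        monomial ζ 0 • HardySpace.eval (f : HardySpace E) ζ :=
    ⟨LinearIsometry.id, fun f ζ => by simp [monomial]⟩
  induction α using Finsupp.induction_linear with
  | zero => exact hzero
  | add α β hα hβ => exact hadd α β hα hβ
  | single n k =>
    induction k with
    | zero => rw [Finsupp.single_zero]; exact hzero
    | succ k ih =>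
      rw [Finsupp.single_add]
      refine hadd _ _ ih ⟨⟨(S.restriction n).toLinearMap, S.norm_restriction n⟩, fun f ζ => ?_⟩
      rw [monomial_single, pow_one]
      exact eval_coordMul n _ ζ

/-- Multiplication by `ζ ^ α` on a submodule; see `HardySubmodule.eval_monomialMul`. -/
def HardySubmodule.monomialMul (S : HardySubmodule E) (α : MultiIndex) :
    S.toSubmodule →ₗᵢ[ℂ] S.toSubmodule :=
  (S.exists_monomialMul α).choose

theorem HardySubmodule.eval_monomialMul (S : HardySubmodule E) (α : MultiIndex)
    (f : S.toSubmodule) (ζ : EllTwo) : HardySpace.eval (S.monomialMul α f : HardySpace E) ζ =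
      monomial ζ α • HardySpace.eval (f : HardySpace E) ζ :=
  (S.exists_monomialMul α).choose_spec f ζ

/-- The elements of a submodule all of whose coefficients of degree less than `k` vanish. -/
def HardySubmodule.degreeFiltration (S : HardySubmodule E) (k : ℕ) :
    Submodule ℂ S.toSubmodule :=
  ⨅ (α : MultiIndex) (_ : α.degree < k), (coeffCLM S.toSubmodule.subtypeₗᵢ α).ker

theorem HardySubmodule.mem_degreeFiltration (S : HardySubmodule E) {k : ℕ} {f : S.toSubmodule} :
    f ∈ S.degreeFiltration k ↔ ∀ α : MultiIndex, α.degree < k → (f : HardySpace E) α = 0 := by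
  simp only [HardySubmodule.degreeFiltration, Submodule.mem_iInf]
  rfl

theorem HardySubmodule.isClosed_degreeFiltration (S : HardySubmodule E) (k : ℕ) :
    IsClosed (S.degreeFiltration k : Set S.toSubmodule) := by
  simp only [HardySubmodule.degreeFiltration, Submodule.coe_iInf]
  exact isClosed_iInter fun α => isClosed_iInter fun _ => ContinuousLinearMap.isClosed_ker _

theorem HardySubmodule.restriction_mem_degreeFiltration (S : HardySubmodule E) (k n : ℕ)
    (f : S.toSubmodule) (hf : f ∈ S.degreeFiltration k) :
    S.restriction n f ∈ S.degreeFiltration (k + 1) := by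
  rw [S.mem_degreeFiltration] at hf ⊢
  intro β hβ
  change shiftCoeff n ((f : HardySpace E) : MultiIndex → E) β = 0
  by_cases h : β ∈ Set.range fun α : MultiIndex => α + Finsupp.single n 1
  · obtain ⟨α, rfl⟩ := h
    rw [shiftCoeff_add_single]
    refine hf α ?_
    simpa [map_add] using hβ
  · exact shiftCoeff_eq_zero n _ h

variable [CompleteSpace E]

theorem HardySubmodule.isMonomialFamily (S : HardySubmodule E) :
    IsMonomialFamily S.restriction S.monomialMul where
  zero f := Subtype.ext <| HardySpace.eval_injective fun ζ _ => by
    rw [S.eval_monomialMul]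
    simp [monomial]
  add_single α n f := Subtype.ext <| HardySpace.eval_injective fun ζ _ => by
    rw [S.eval_monomialMul, S.coe_restriction, eval_coordMul, S.eval_monomialMul, monomial_add,
      monomial_single, pow_one, smul_smul, mul_comm]

/-- The orthogonal family assembles into an isometry of `H²_W` onto `S`. Evaluating its series at
`ζ` pulls out the scalars `ζ ^ α`, which exhibits it as multiplication by `evalCLM V`, with `V` the
inclusion of `W`. -/
theorem HardySubmodule.exists_isInner_of_orthogonalFamily (S : HardySubmodule E) {W : Type*}
    [NormedAddCommGroup W] [InnerProductSpace ℂ W] [CompleteSpace W]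
    (j : W →ₗᵢ[ℂ] S.toSubmodule)
    (hj : OrthogonalFamily ℂ (fun _ : MultiIndex => W) fun α => (S.monomialMul α).comp j)
    (htop : (⨆ α, ((S.monomialMul α).comp j).range).topologicalClosure = ⊤) :
    ∃ Ψ : EllTwo → W →L[ℂ] E, IsInner Ψ ∧
      (S.toSubmodule : Set (HardySpace E)) = mulImage Ψ := by
  let V : W →ₗᵢ[ℂ] HardySpace E := S.toSubmodule.subtypeₗᵢ.comp j
  let T : HardySpace W →ₗᵢ[ℂ] HardySpace E := S.toSubmodule.subtypeₗᵢ.comp hj.linearIsometry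
  have hT : IsMultiplicationOperator (evalCLM V) T.toContinuousLinearMap := by
    intro G ζ hζ
    have h1 : HasSum (fun α => (S.monomialMul α (j (G α)) : HardySpace E)) (T G) :=
      (hj.hasSum_linearIsometry G).mapL S.toSubmodule.subtypeL
    have h2 := hasSum_eval h1 hζ
    have h3 := (G.summable_eval hζ).hasSum.mapL (evalCLM V ζ)
    refine h2.unique (h3.congr_fun fun α => ?_)
    rw [S.eval_monomialMul, map_smul, evalCLM_apply V hζ]
    rfl
  have hrange : Set.range T = S.toSubmodule := by
    have h1 : hj.linearIsometry.toLinearMap.range = ⊤ := hj.range_linearIsometry.trans htop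
    ext f
    constructor
    · rintro ⟨G, rfl⟩
      exact (hj.linearIsometry G).2
    · intro hf
      obtain ⟨G, hG⟩ := LinearMap.range_eq_top.1 h1 ⟨f, hf⟩
      exact ⟨G, congrArg Subtype.val hG⟩
  refine ⟨evalCLM V, ⟨⟨differentiableOn_evalCLM V, 1, fun ζ hζ => ?_⟩, ?_⟩, ?_⟩
  · exact hT.norm_le_one T.norm_map hζ
  · exact ⟨_, hT, T.isometry⟩
  · rw [hT.mulImage_eq_range]
    exact hrange.symm

theorem HardySubmodule.IsDoublyCommuting.exists_isInner {E : Type u} [NormedAddCommGroup E]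
    [InnerProductSpace ℂ E] [CompleteSpace E] {S : HardySubmodule E} (hS : S.IsDoublyCommuting) :
    ∃ (F : Type u) (_ : NormedAddCommGroup F) (_ : InnerProductSpace ℂ F) (_ : CompleteSpace F)
      (Ψ : EllTwo → F →L[ℂ] E),
      IsInner Ψ ∧ (S.toSubmodule : Set (HardySpace E)) = mulImage Ψ := by
  have h0 : S.degreeFiltration 0 = ⊤ := by
    refine Submodule.eq_top_iff'.2 fun f => S.mem_degreeFiltration.2 fun α hα => ?_
    exact absurd hα (Nat.not_lt_zero _)
  have hbot : ⨅ k, S.degreeFiltration k = ⊥ := by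
    refine (Submodule.eq_bot_iff _).2 fun f hf => Subtype.ext (lp.ext (funext fun α => ?_))
    exact S.mem_degreeFiltration.1 ((Submodule.mem_iInf _).1 hf (α.degree + 1)) α
      (Nat.lt_succ_self _)
  obtain ⟨W, _, _, _, j, hj, htop⟩ := exists_orthogonalFamily_monomial hS S.norm_restriction
    S.isMonomialFamily S.degreeFiltration S.isClosed_degreeFiltration h0
    S.restriction_mem_degreeFiltration hbot
  exact ⟨W, _, _, ‹_›, S.exists_isInner_of_orthogonalFamily j hj htop⟩

end Submodule

/-! ### From an inner function to double commutation. -/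

section UnitaryEquivalence

open ContinuousLinearMap (adjoint)

variable {H K : Type*} [NormedAddCommGroup H] [InnerProductSpace ℂ H] [CompleteSpace H]
  [NormedAddCommGroup K] [InnerProductSpace ℂ K] [CompleteSpace K]

/-- A unitary that intertwines two operators also intertwines their adjoints; surjectivity of `U` is
essential here. -/
theorem DoublyCommuting.of_unitaryEquiv {M : ℕ → K →L[ℂ] K} {R : ℕ → H →L[ℂ] H}
    (hM : DoublyCommuting M) (U : K ≃ₗᵢ[ℂ] H) (hU : ∀ n f, R n (U f) = U (M n f)) :
    DoublyCommuting R := by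
  have hadj : ∀ n f, adjoint (R n) (U f) = U (adjoint (M n) f) := by
    intro n f
    refine ext_inner_left ℂ fun g => ?_
    obtain ⟨g, rfl⟩ := U.surjective g
    rw [ContinuousLinearMap.adjoint_inner_right, hU, U.inner_map_map, U.inner_map_map,
      ContinuousLinearMap.adjoint_inner_right]
  intro m n hmn
  refine ⟨ContinuousLinearMap.ext fun f => ?_, ContinuousLinearMap.ext fun f => ?_⟩
  · obtain ⟨f, rfl⟩ := U.surjective f
    have := DFunLike.congr_fun (hM m n hmn).1 f
    simp only [ContinuousLinearMap.comp_apply, hU] at this ⊢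
    rw [this]
  · obtain ⟨f, rfl⟩ := U.surjective f
    have := DFunLike.congr_fun (hM m n hmn).2 f
    simp only [ContinuousLinearMap.comp_apply, hU, hadj] at this ⊢
    rw [this]

variable {F : Type*} [NormedAddCommGroup F] [InnerProductSpace ℂ F]

theorem coordMul_apply (n : ℕ) (f : HardySpace F) (β : MultiIndex) :
    coordMul F n f β = shiftCoeff n (f : MultiIndex → F) β := rfl

theorem coordMul_single (n : ℕ) (α : MultiIndex) (v : F) :
    coordMul F n (lp.single 2 α v) = lp.single 2 (α + Finsupp.single n 1) v := by
  ext β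
  rw [coordMul_apply, lp.coeFn_single, lp.coeFn_single]
  by_cases h : β ∈ Set.range fun γ : MultiIndex => γ + Finsupp.single n 1
  · obtain ⟨γ, rfl⟩ := h
    simp [shiftCoeff_add_single, Pi.single_apply]
  · rw [shiftCoeff_eq_zero n _ h, Pi.single_eq_of_ne]
    rintro rfl
    exact h ⟨α, rfl⟩

theorem coordMul_comm (m n : ℕ) [CompleteSpace F] (f : HardySpace F) :
    coordMul F m (coordMul F n f) = coordMul F n (coordMul F m f) :=
  HardySpace.eval_injective fun ζ _ => by
    simp only [eval_coordMul, smul_smul, mul_comm]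

variable [CompleteSpace F]

theorem adjoint_coordMul_apply (n : ℕ) (f : HardySpace F) (α : MultiIndex) :
    adjoint (coordMul F n).toContinuousLinearMap f α = f (α + Finsupp.single n 1) := by
  refine ext_inner_left ℂ fun v => ?_
  refine (lp.inner_single_left (𝕜 := ℂ) (G := fun _ : MultiIndex => F) α v _).symm.trans (Eq.trans ?_ (lp.inner_single_left _ v f))
  rw [ContinuousLinearMap.adjoint_inner_right, LinearIsometry.coe_toContinuousLinearMap,
    coordMul_single]

theorem doublyCommuting_coordMul :
    DoublyCommuting fun n => (coordMul F n).toContinuousLinearMap := by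
  intro m n hmn
  refine ⟨ContinuousLinearMap.ext fun f => coordMul_comm m n f,
    ContinuousLinearMap.ext fun f => lp.ext (funext fun β => ?_)⟩
  simp only [ContinuousLinearMap.comp_apply, LinearIsometry.coe_toContinuousLinearMap]
  rw [adjoint_coordMul_apply, coordMul_apply, coordMul_apply]
  -- Since `m ≠ n`, adding a unit at `m` leaves the exponent at `n` unchanged, so both sides vanish
  -- together when that exponent is `0`.
  by_cases h : β n = 0
  · rw [shiftCoeff_eq_zero, shiftCoeff_eq_zero]
    · rintro ⟨γ, rfl⟩
      simp at h
    · rintro ⟨γ, hγ⟩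
      have := DFunLike.congr_fun hγ n
      simp [h, hmn] at this
  · obtain ⟨γ, rfl⟩ := exists_eq_add_single h
    rw [add_right_comm, shiftCoeff_add_single, shiftCoeff_add_single, adjoint_coordMul_apply]

/-- `M_Ψ`, with codomain cut down to its range `S`, is unitary and commutes with multiplication by
each scalar function `ζ n`. It therefore transports double commutation from `H²_F`; the adjoints are
those of operators on `S`, as required. -/
theorem IsInner.isDoublyCommuting {E : Type*} [NormedAddCommGroup E] [InnerProductSpace ℂ E]
    [CompleteSpace E] {S : HardySubmodule E} {Ψ : EllTwo → F →L[ℂ] E} (hΨ : IsInner Ψ)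
    (hS : (S.toSubmodule : Set (HardySpace E)) = mulImage Ψ) : S.IsDoublyCommuting := by
  obtain ⟨T, hT, hiso⟩ := hΨ.isometry
  rw [hT.mulImage_eq_range] at hS
  have hmem : ∀ G, T G ∈ S.toSubmodule := fun G => by
    rw [← SetLike.mem_coe, hS]
    exact ⟨G, rfl⟩
  let V : HardySpace F →ₗᵢ[ℂ] S.toSubmodule :=
    ⟨T.toLinearMap.codRestrict S.toSubmodule hmem,
      (AddMonoidHomClass.isometry_iff_norm T).1 hiso⟩
  have hV : Function.Surjective V := by
    rintro ⟨f, hf⟩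
    rw [← SetLike.mem_coe, hS] at hf
    obtain ⟨G, rfl⟩ := hf
    exact ⟨G, rfl⟩
  refine doublyCommuting_coordMul.of_unitaryEquiv (LinearIsometryEquiv.ofSurjective V hV)
    fun n G => Subtype.ext ?_
  change coordMul E n (T G) = T (coordMul F n G)
  refine HardySpace.eval_injective fun ζ hζ => ?_
  rw [eval_coordMul, hT _ ζ hζ, hT _ ζ hζ, eval_coordMul, map_smul]

end UnitaryEquivalence

end HardyInfinite

end

theorem mainTheorem7 {E : Type u} [NormedAddCommGroup E] [InnerProductSpace ℂ E]
    [CompleteSpace E] (S : HardyInfinite.HardySubmodule E) :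
    S.IsDoublyCommuting ↔
      ∃ (F : Type u) (_ : NormedAddCommGroup F) (_ : InnerProductSpace ℂ F) (_ : CompleteSpace F)
        (Ψ : HardyInfinite.EllTwo → F →L[ℂ] E),
        HardyInfinite.IsInner Ψ ∧
          (S.toSubmodule : Set (HardyInfinite.HardySpace E)) = HardyInfinite.mulImage Ψ :=
  ⟨fun hS => hS.exists_isInner, fun ⟨_, _, _, _, _, hΨ, hS⟩ => hΨ.isDoublyCommuting hS⟩
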